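/- Let $\mathcal H$ be a finite-dimensional real or complex inner product space, let $A:\mathcal H\to\mathcal H$ be a Hermitian linear operator, and let $\mathcal X,\mathcal Y\subseteq\mathcal H$ be subspaces with $\dim\mathcal X=\dim\mathcal Y=n$. For a subspace $\mathcal Z$ let $P_{\mathcal Z}$ be the orthogonal projector onto $\mathcal Z$, let $(P_{\mathcal Z}A)|_{\mathcal Z}$ be the restriction of $P_{\mathcal Z}A$ to $\mathcal Z$, and let $\Lambda((P_{\mathcal Z}A)|_{\mathcal Z})$ be the vector of its eigenvalues (the Ritz values of $A$ with respect to $\mathcal Z$), in decreasing order and repeated according to multiplicity. Let $\Theta(\mathcal X,\mathcal Y)=[\theta_1\ge\cdots\ge\theta_n]$, with $\theta_i\in[0,\pi/2]$, be the vector of principal angles between $\mathcal X$ and $\mathcal Y$: $\cos^2\theta_1\le\cdots\le\cos^2\theta_n$ are the eigenvalues of $(P_{\mathcal X}P_{\mathcal Y})|_{\mathcal X}$, in increasing order and repeated according to multiplicity. For $x,y\in\mathbb R^n$ write $x\prec_w y$ if $\sum_{i=1}^k x_i^\downarrow\le\sum_{i=1}^k y_i^\downarrow$ for $k=1,\dots,n$,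 where $x^\downarrow$ is $x$ with its entries rearranged in decreasing order. Absolute values, $\sin$ and $\sin^2$ of vectors are taken entrywise. Let $\lambda_{\max(\mathcal X+\mathcal Y)}$ and $\lambda_{\min(\mathcal X+\mathcal Y)}$ be the largest and the smallest eigenvalue of $(P_{\mathcal X+\mathcal Y}A)|_{\mathcal X+\mathcal Y}$ (if $n=0$ all the vectors are empty and there is nothing to prove). Then $$\bigl|\Lambda((P_{\mathcal X}A)|_{\mathcal X})-\Lambda((P_{\mathcal Y}A)|_{\mathcal Y})\bigr|\prec_w\bigl(\lambda_{\max(\mathcal X+\mathcal Y)}-\lambda_{\min(\mathcal X+\mathcal Y)}\bigr)\,\sin\Theta(\mathcal X,\mathcal Y).$$ If moreover $\mathcal X$ or $\mathcal Y$ is $A$-invariant, then $$\bigl|\Lambda((P_{\mathcal X}A)|_{\mathcal X})-\Lambda((P_{\mathcal Y}A)|_{\mathcal Y})\bigr|\prec_w\bigl(\lambda_{\max(\mathcal X+\mathcal Y)}-\lambda_{\min(\mathcal X+\mathcal Y)}\bigr)\,\sin^2\Theta(\mathcal X,\mathcal Y).$$ -/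

import Mathlib

namespace RayleighRitz

noncomputable section

/-- The vector `x↓` obtained by rearranging the entries of `x` in decreasing order. -/
def decreasing {n : ℕ} (x : Fin n → ℝ) : Fin n → ℝ :=
  x ∘ Tuple.sort (fun i => OrderDual.toDual (x i))

theorem decreasing_antitone {n : ℕ} (x : Fin n → ℝ) : Antitone (decreasing x) := fun _ _ hij =>
  OrderDual.toDual_le_toDual.mp (Tuple.monotone_sort (fun i => OrderDual.toDual (x i)) hij)

/-- Weak (sub-)majorization `x ≺_w y`: for `k = 1, …, n`, the sum of the `k` largest entries of `x`
is at most the sum of the `k` largest entries of `y`. -/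
def WeaklyMajorizedBy {n : ℕ} (x y : Fin n → ℝ) : Prop :=
  ∀ k : ℕ, 1 ≤ k → k ≤ n →
    ∑ i : Fin n with i.val < k, decreasing x i ≤ ∑ i : Fin n with i.val < k, decreasing y i

variable {𝕜 H : Type*} [RCLike 𝕜] [NormedAddCommGroup H] [InnerProductSpace 𝕜 H]
  [FiniteDimensional 𝕜 H]

/-- The Rayleigh-Ritz operator `(P_X A)|_X` on the subspace `X`, where `P_X` is the orthogonal
projector onto `X`. -/
def compression (A : H →ₗ[𝕜] H) (X : Submodule 𝕜 H) : X →ₗ[𝕜] X :=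
  (X.orthogonalProjectionOnto : H →ₗ[𝕜] X) ∘ₗ A ∘ₗ X.subtype

theorem compression_isSymmetric {A : H →ₗ[𝕜] H} (hA : A.IsSymmetric) (X : Submodule 𝕜 H) :
    (compression A X).IsSymmetric := by
  intro x y
  simp only [compression, LinearMap.comp_apply, ContinuousLinearMap.coe_coe,
    Submodule.subtype_apply, Submodule.inner_orthogonalProjectionOnto_eq_of_mem_left,
    Submodule.inner_orthogonalProjectionOnto_eq_of_mem_right]
  exact hA x y

/-- The Ritz values of the Hermitian operator `A` with respect to `X`: the eigenvalues of
`(P_X A)|_X`, in decreasing order and repeated according to multiplicity. -/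
def ritzValues {A : H →ₗ[𝕜] H} (hA : A.IsSymmetric) (X : Submodule 𝕜 H) {n : ℕ}
    (hn : Module.finrank 𝕜 X = n) : Fin n → ℝ :=
  (compression_isSymmetric hA X).eigenvalues hn

/-- The largest eigenvalue of `(P_Z A)|_Z` (with value `0` when `Z` is the zero subspace). -/
def ritzMax {A : H →ₗ[𝕜] H} (hA : A.IsSymmetric) (Z : Submodule 𝕜 H) : ℝ :=
  ⨆ i, ritzValues hA Z rfl i

/-- The smallest eigenvalue of `(P_Z A)|_Z` (with value `0` when `Z` is the zero subspace). -/
def ritzMin {A : H →ₗ[𝕜] H} (hA : A.IsSymmetric) (Z : Submodule 𝕜 H) : ℝ :=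
  ⨅ i, ritzValues hA Z rfl i

/-- The vector of squared cosines of the principal angles from `X` to `Y`: the eigenvalues of
`(P_X P_Y)|_X`, in increasing order. -/
def cosSqAngles (X Y : Submodule 𝕜 H) {n : ℕ} (hn : Module.finrank 𝕜 X = n) : Fin n → ℝ :=
  fun i => ritzValues (Submodule.starProjection_isSymmetric (K := Y)) X hn i.rev

/-- The vector `Θ(X, Y)` of principal angles from `X` to `Y`: the angles in `[0, π/2]`, in
decreasing order, whose squared cosines are `cosSqAngles`. -/
def principalAngles (X Y : Submodule 𝕜 H) {n : ℕ} (hn : Module.finrank 𝕜 X = n) : Fin n → ℝ :=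
  fun i => Real.arccos (√(cosSqAngles X Y hn i))

end

end RayleighRitz

/-!
Throughout, Hermitian operators are compared through their quadratic forms `re ⟪T x, x⟫`, and the
Courant–Fischer principle (`le_eigenvalues_of_forall_mem`, `eigenvalues_le_of_forall_mem`) turns
such comparisons into comparisons of ordered eigenvalues.

Let `Z = X + Y`, and let `a`, `b` be the extreme Ritz values of `A` on `Z`. The operators
`P_Z (A - a) P_Z = G²` and `P_Z (b - A) P_Z = G'²` are positive with `G² + G'² ≤ b - a`. The Ritz
values of `G²` on `X` and `Y` are those of `A` shifted by `a`, while the ones of `G'²` are those of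
`A` reflected and in the reversed order. Hence every positive difference of a Ritz value of `A` on
`X` and one on `Y` is such a difference for `G²`, and every negative one is, up to its sign, a
positive difference for `G'²`. As `T*T` and
`TT*` have the same eigenvalues up to zeros (`eigenvalues_adjoint_comp_eq`), the Ritz values of `G²`
on `X` are the leading eigenvalues of `G P_X G`, an operator on the whole space.

The heart is `sum_eigenvalues_conj_sub_le`. For a level `t ≥ 0` write `P - Q ≤ t + R`, where
`R = (P - Q - t)₊`. Then `G P G ≤ G Q G + (b - a) t + G R G`, and a Lidskii type inequality
(`sum_eigenvalues_sub_le`) bounds the sum of any `k` of the eigenvalue increases from `G Q G` to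
`G P G` by `(b - a) k t + tr (G R G)`. The same holds for `G'`, and the two traces together are at
most `(b - a) tr R`: although signed differences of both kinds occur, only one copy of the positive
part of the spectrum of `P - Q` is spent. Choosing for `t` the `k`-th entry of a vector that
dominates this spectrum gives weak majorization (`weaklyMajorizedBy_of_threshold`).

For the first bound `P = P_X` and `Q = P_Y`; the positive eigenvalues of `P_X - P_Y` are at most the
sines of the principal angles (`norm_sq_sub_norm_starProjection_sq_le`). If `X` is invariant,
then `G²` dominates `P_X G² P_X`, so that `Q` may be replaced by `P_X P_Y P_X`; the positive
eigenvalues of `P_X - P_X P_Y P_X` are at most the squared sines. The case of an invariant `Y`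
follows by symmetry of the principal angles.
-/

namespace RayleighRitz

noncomputable section

open RCLike

variable {𝕜 : Type*} [RCLike 𝕜]

local notation "⟪" x ", " y "⟫" => inner 𝕜 x y

section Operators

variable {E F : Type*} [NormedAddCommGroup E] [InnerProductSpace 𝕜 E]
  [NormedAddCommGroup F] [InnerProductSpace 𝕜 F]

/-! ### Operators diagonal in an orthonormal basis -/

/-- The operator that is diagonal in the orthonormal basis `b`, with diagonal entries `f`. -/
def diagOp {ι : Type*} [Fintype ι] (b : OrthonormalBasis ι 𝕜 E) (f : ι → ℝ) : E →ₗ[𝕜] E :=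
  b.toBasis.constr 𝕜 fun i => (f i : 𝕜) • b i

section diagOp

variable {ι : Type*} [Fintype ι] (b : OrthonormalBasis ι 𝕜 E) (f : ι → ℝ)

theorem diagOp_apply_basis (i : ι) : diagOp b f (b i) = (f i : 𝕜) • b i := by
  have := b.toBasis.constr_basis 𝕜 (fun i => (f i : 𝕜) • b i) i
  rwa [OrthonormalBasis.coe_toBasis] at this

theorem inner_basis_diagOp (x : E) (i : ι) : ⟪b i, diagOp b f x⟫ = (f i : 𝕜) * ⟪b i, x⟫ := by
  classical
  conv_lhs => rw [← b.sum_repr' x]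
  simp [map_sum, diagOp_apply_basis, inner_sum, inner_smul_right,
    orthonormal_iff_ite.mp b.orthonormal, mul_comm]

theorem diagOp_isSymmetric : (diagOp b f).IsSymmetric := by
  intro x y
  rw [← b.sum_inner_mul_inner, ← b.sum_inner_mul_inner]
  refine Finset.sum_congr rfl fun i _ => ?_
  rw [inner_basis_diagOp, ← inner_conj_symm, inner_basis_diagOp, map_mul, conj_ofReal,
    inner_conj_symm]
  ring

theorem re_inner_diagOp (x : E) :
    re ⟪diagOp b f x, x⟫ = ∑ i, f i * ‖⟪b i, x⟫‖ ^ 2 := by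
  rw [← b.sum_inner_mul_inner, map_sum]
  refine Finset.sum_congr rfl fun i _ => ?_
  rw [← inner_conj_symm (diagOp b f x), inner_basis_diagOp, map_mul (starRingEnd 𝕜), conj_ofReal,
    mul_assoc, RCLike.conj_mul]
  norm_cast

theorem re_trace_diagOp_comp (B : E →ₗ[𝕜] E) :
    re (LinearMap.trace 𝕜 E (diagOp b f ∘ₗ B)) = ∑ i, f i * re ⟪B (b i), b i⟫ := by
  rw [LinearMap.trace_eq_sum_inner _ b, map_sum]
  refine Finset.sum_congr rfl fun i _ => ?_
  rw [LinearMap.comp_apply, inner_basis_diagOp, re_ofReal_mul, inner_re_symm]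

end diagOp

theorem finrank_span_image_orthonormalBasis {ι : Type*} [Fintype ι] [DecidableEq ι]
    (b : OrthonormalBasis ι 𝕜 E) (s : Finset ι) :
    Module.finrank 𝕜 (Submodule.span 𝕜 (b '' s)) = s.card := by
  have h : LinearIndependent 𝕜 fun i : s => b i :=
    b.orthonormal.linearIndependent.comp _ Subtype.val_injective
  have := finrank_span_eq_card h
  rw [Fintype.card_coe] at this
  rw [← this, Set.image_eq_range]
  rfl

theorem inner_eq_zero_of_mem_span_image {ι : Type*} [Fintype ι]
    (b : OrthonormalBasis ι 𝕜 E) {s : Finset ι} {v : E} (hv : v ∈ Submodule.span 𝕜 (b '' s)) {j : ι}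
    (hj : j ∉ s) : ⟪b j, v⟫ = 0 := by
  classical
  induction hv using Submodule.span_induction with
  | mem x hx =>
    obtain ⟨i, hi, rfl⟩ := hx
    rw [orthonormal_iff_ite.mp b.orthonormal, if_neg]
    rintro rfl
    exact hj hi
  | zero => exact inner_zero_right _
  | add x y _ _ hx hy => rw [inner_add_right, hx, hy, add_zero]
  | smul a x _ hx => rw [inner_smul_right, hx, mul_zero]

theorem isSymmetric_conj {G P : E →ₗ[𝕜] E} (hG : G.IsSymmetric) (hP : P.IsSymmetric) :
    (G ∘ₗ P ∘ₗ G).IsSymmetric := fun x y => by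
  simp only [LinearMap.comp_apply]
  rw [hG, hP, hG]

theorem re_inner_conj {G : E →ₗ[𝕜] E} (hG : G.IsSymmetric) (P : E →ₗ[𝕜] E) (x : E) :
    re ⟪(G ∘ₗ P ∘ₗ G) x, x⟫ = re ⟪P (G x), G x⟫ := by
  rw [LinearMap.comp_apply, hG, LinearMap.comp_apply]

theorem norm_add_sq_of_mem_orthogonal {X : Submodule 𝕜 E} {x z : E} (hx : x ∈ X) (hz : z ∈ Xᗮ) :
    ‖x + z‖ ^ 2 = ‖x‖ ^ 2 + ‖z‖ ^ 2 := by
  rw [norm_add_sq (𝕜 := 𝕜), hz x hx]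
  simp

variable [FiniteDimensional 𝕜 E] [FiniteDimensional 𝕜 F]

theorem eq_diagOp_eigenvectorBasis {T : E →ₗ[𝕜] E} (hT : T.IsSymmetric) {n : ℕ}
    (hn : Module.finrank 𝕜 E = n) : T = diagOp (hT.eigenvectorBasis hn) (hT.eigenvalues hn) := by
  refine (hT.eigenvectorBasis hn).toBasis.ext fun i => ?_
  rw [OrthonormalBasis.coe_toBasis, diagOp_apply_basis, hT.apply_eigenvectorBasis]

theorem re_inner_eq_sum_eigenvalues {T : E →ₗ[𝕜] E} (hT : T.IsSymmetric) {n : ℕ}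
    (hn : Module.finrank 𝕜 E = n) (x : E) :
    re ⟪T x, x⟫ = ∑ i, hT.eigenvalues hn i * ‖⟪hT.eigenvectorBasis hn i, x⟫‖ ^ 2 := by
  conv_lhs => rw [eq_diagOp_eigenvectorBasis hT hn]
  exact re_inner_diagOp _ _ x

/-- A positive semidefinite operator has a Hermitian square root. -/
theorem exists_isSymmetric_sqrt {T : E →ₗ[𝕜] E} (hT : T.IsSymmetric)
    (h0 : ∀ x, 0 ≤ re ⟪T x, x⟫) :
    ∃ G : E →ₗ[𝕜] E, G.IsSymmetric ∧ ∀ x, G (G x) = T x := by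
  set b := hT.eigenvectorBasis rfl
  have hev : ∀ i, 0 ≤ hT.eigenvalues rfl i := fun i =>
    (LinearMap.IsPositive.nonneg_eigenvalues ⟨hT, h0⟩ rfl i)
  refine ⟨diagOp b fun i => √(hT.eigenvalues rfl i), diagOp_isSymmetric _ _, fun x => ?_⟩
  refine b.repr.injective (PiLp.ext fun i => ?_)
  have : ⟪b i, T x⟫ = (hT.eigenvalues rfl i : 𝕜) * ⟪b i, x⟫ := by
    rw [← hT, hT.apply_eigenvectorBasis, inner_smul_left, conj_ofReal]
  rw [b.repr_apply_apply, b.repr_apply_apply, inner_basis_diagOp, inner_basis_diagOp, this,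
    ← mul_assoc,
    ← ofReal_mul, Real.mul_self_sqrt (hev i)]

/-- The excess `R = (D - t)₊` of a Hermitian operator `D` over the level `t`. Its trace against an
operator `B ≤ c` is controlled by the excesses of the eigenvalues. -/
theorem exists_excess {D : E →ₗ[𝕜] E} (hD : D.IsSymmetric) (t : ℝ) :
    ∃ R : E →ₗ[𝕜] E, R.IsSymmetric ∧ (∀ x, 0 ≤ re ⟪R x, x⟫) ∧
      (∀ x, re ⟪D x, x⟫ ≤ t * ‖x‖ ^ 2 + re ⟪R x, x⟫) ∧
      ∀ (B : E →ₗ[𝕜] E) (c : ℝ), (∀ x, re ⟪B x, x⟫ ≤ c * ‖x‖ ^ 2) →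
        re (LinearMap.trace 𝕜 E (R ∘ₗ B)) ≤ c * ∑ i, max (hD.eigenvalues rfl i - t) 0 := by
  set b := hD.eigenvectorBasis rfl
  refine ⟨diagOp b fun i => max (hD.eigenvalues rfl i - t) 0, diagOp_isSymmetric _ _, fun x => ?_,
    fun x => ?_, fun B c hB => ?_⟩
  · rw [re_inner_diagOp]
    positivity
  · rw [re_inner_diagOp, re_inner_eq_sum_eigenvalues hD rfl, ← b.sum_sq_norm_inner_right x,
      Finset.mul_sum, ← Finset.sum_add_distrib]
    refine Finset.sum_le_sum fun i _ => ?_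
    rw [← add_mul]
    gcongr
    linarith [le_max_left (hD.eigenvalues rfl i - t) 0]
  · rw [re_trace_diagOp_comp, Finset.mul_sum]
    refine Finset.sum_le_sum fun i _ => ?_
    rw [mul_comm c]
    have := hB (b i)
    rw [b.norm_eq_one, one_pow, mul_one] at this
    gcongr

/-! ### The Courant–Fischer principle and its consequences -/

theorem exists_submodule_le_re_inner {T : E →ₗ[𝕜] E} (hT : T.IsSymmetric) {n : ℕ}
    (hn : Module.finrank 𝕜 E = n) (i : Fin n) :
    ∃ V : Submodule 𝕜 E, Module.finrank 𝕜 V = i + 1 ∧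
      ∀ v ∈ V, hT.eigenvalues hn i * ‖v‖ ^ 2 ≤ re ⟪T v, v⟫ := by
  refine ⟨Submodule.span 𝕜 (hT.eigenvectorBasis hn '' (Finset.Iic i)), ?_, fun v hv => ?_⟩
  · rw [finrank_span_image_orthonormalBasis, Fin.card_Iic]
  · rw [re_inner_eq_sum_eigenvalues hT hn,
      ← (hT.eigenvectorBasis hn).sum_sq_norm_inner_right v, Finset.mul_sum]
    refine Finset.sum_le_sum fun j _ => ?_
    by_cases hj : j ∈ Finset.Iic i
    · gcongr
      exact hT.eigenvalues_antitone hn (Finset.mem_Iic.mp hj)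
    · simp [inner_eq_zero_of_mem_span_image _ hv hj]

theorem exists_submodule_re_inner_le {T : E →ₗ[𝕜] E} (hT : T.IsSymmetric) {n : ℕ}
    (hn : Module.finrank 𝕜 E = n) (i : Fin n) :
    ∃ V : Submodule 𝕜 E, Module.finrank 𝕜 V + i = n ∧
      ∀ v ∈ V, re ⟪T v, v⟫ ≤ hT.eigenvalues hn i * ‖v‖ ^ 2 := by
  refine ⟨Submodule.span 𝕜 (hT.eigenvectorBasis hn '' (Finset.Ici i)), ?_, fun v hv => ?_⟩
  · rw [finrank_span_image_orthonormalBasis, Fin.card_Ici]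
    omega
  · rw [re_inner_eq_sum_eigenvalues hT hn,
      ← (hT.eigenvectorBasis hn).sum_sq_norm_inner_right v, Finset.mul_sum]
    refine Finset.sum_le_sum fun j _ => ?_
    by_cases hj : j ∈ Finset.Ici i
    · gcongr
      exact hT.eigenvalues_antitone hn (Finset.mem_Ici.mp hj)
    · simp [inner_eq_zero_of_mem_span_image _ hv hj]

theorem exists_mem_inf_ne_zero {V W : Submodule 𝕜 E}
    (h : Module.finrank 𝕜 E < Module.finrank 𝕜 V + Module.finrank 𝕜 W) :
    ∃ v, v ∈ V ∧ v ∈ W ∧ v ≠ 0 := by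
  have h1 := Submodule.finrank_sup_add_finrank_inf_eq V W
  have h2 := Submodule.finrank_le (V ⊔ W)
  have h3 : V ⊓ W ≠ ⊥ := fun h0 => by
    rw [h0, finrank_bot] at h1
    omega
  obtain ⟨v, hv, hv0⟩ := Submodule.exists_mem_ne_zero_of_ne_bot h3
  exact ⟨v, hv.1, hv.2, hv0⟩

/-- Lower half of the Courant–Fischer principle. -/
theorem le_eigenvalues_of_forall_mem {T : E →ₗ[𝕜] E} (hT : T.IsSymmetric) {n : ℕ}
    (hn : Module.finrank 𝕜 E = n) {i : Fin n} {V : Submodule 𝕜 E} (hV : i < Module.finrank 𝕜 V)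
    {r : ℝ} (h : ∀ v ∈ V, r * ‖v‖ ^ 2 ≤ re ⟪T v, v⟫) : r ≤ hT.eigenvalues hn i := by
  obtain ⟨W, hW, hWT⟩ := exists_submodule_re_inner_le hT hn i
  obtain ⟨v, hvV, hvW, hv0⟩ := exists_mem_inf_ne_zero (V := V) (W := W) (by omega)
  exact le_of_mul_le_mul_right ((h v hvV).trans (hWT v hvW)) (by positivity)

/-- Upper half of the Courant–Fischer principle. -/
theorem eigenvalues_le_of_forall_mem {T : E →ₗ[𝕜] E} (hT : T.IsSymmetric) {n : ℕ}
    (hn : Module.finrank 𝕜 E = n) {i : Fin n} {V : Submodule 𝕜 E}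
    (hV : n ≤ Module.finrank 𝕜 V + i) {r : ℝ} (h : ∀ v ∈ V, re ⟪T v, v⟫ ≤ r * ‖v‖ ^ 2) :
    hT.eigenvalues hn i ≤ r := by
  obtain ⟨W, hW, hWT⟩ := exists_submodule_le_re_inner hT hn i
  obtain ⟨v, hvV, hvW, hv0⟩ := exists_mem_inf_ne_zero (V := V) (W := W) (by omega)
  exact le_of_mul_le_mul_right ((hWT v hvW).trans (h v hvV)) (by positivity)

/-- Weyl monotonicity: `C + s ≤ D` implies `λᵢ(C) + s ≤ λᵢ(D)`. -/
theorem eigenvalues_add_le_eigenvalues {C D : E →ₗ[𝕜] E} (hC : C.IsSymmetric) (hD : D.IsSymmetric)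
    {n : ℕ} (hn : Module.finrank 𝕜 E = n) {s : ℝ}
    (h : ∀ x, re ⟪C x, x⟫ + s * ‖x‖ ^ 2 ≤ re ⟪D x, x⟫) (i : Fin n) :
    hC.eigenvalues hn i + s ≤ hD.eigenvalues hn i := by
  obtain ⟨V, hV, hVC⟩ := exists_submodule_le_re_inner hC hn i
  refine le_eigenvalues_of_forall_mem hD hn (V := V) (by omega) fun v hv => ?_
  linarith [h v, hVC v hv]

theorem eigenvalues_eq_add {C D : E →ₗ[𝕜] E} (hC : C.IsSymmetric) (hD : D.IsSymmetric)
    {n : ℕ} (hn : Module.finrank 𝕜 E = n) {s : ℝ}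
    (h : ∀ x, re ⟪D x, x⟫ = re ⟪C x, x⟫ + s * ‖x‖ ^ 2) (i : Fin n) :
    hD.eigenvalues hn i = hC.eigenvalues hn i + s := by
  have h1 := eigenvalues_add_le_eigenvalues hC hD hn (fun x => (h x).ge) i
  have h2 := eigenvalues_add_le_eigenvalues hD hC hn (s := -s) (fun x => by linarith [h x]) i
  linarith

/-- The eigenvalues of `s - C` are those of `C`, reflected and in the reversed order. -/
theorem eigenvalues_eq_sub_rev {C D : E →ₗ[𝕜] E} (hC : C.IsSymmetric) (hD : D.IsSymmetric)
    {n : ℕ} (hn : Module.finrank 𝕜 E = n) {s : ℝ}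
    (h : ∀ x, re ⟪C x, x⟫ + re ⟪D x, x⟫ = s * ‖x‖ ^ 2) (i : Fin n) :
    hD.eigenvalues hn i = s - hC.eigenvalues hn i.rev := by
  have hrev := Fin.val_rev i
  refine le_antisymm ?_ ?_
  · obtain ⟨V, hV, hVD⟩ := exists_submodule_le_re_inner hD hn i
    rw [le_sub_comm]
    refine eigenvalues_le_of_forall_mem hC hn (V := V) (by omega) fun v hv => ?_
    linarith [h v, hVD v hv]
  · obtain ⟨V, hV, hVD⟩ := exists_submodule_re_inner_le hD hn i
    rw [sub_le_comm]
    refine le_eigenvalues_of_forall_mem hC hn (V := V) (by omega) fun v hv => ?_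
    linarith [h v, hVD v hv]

theorem eigenvalues_adjoint_comp_le {S : E →ₗ[𝕜] E} {S' : F →ₗ[𝕜] F} (hS : S.IsSymmetric)
    (hS' : S'.IsSymmetric) {T : E →ₗ[𝕜] F} {T' : F →ₗ[𝕜] E} (hadj : ∀ x y, ⟪T x, y⟫ = ⟪x, T' y⟫)
    (hST : ∀ x, re ⟪S x, x⟫ = ‖T x‖ ^ 2) (hST' : ∀ y, re ⟪S' y, y⟫ = ‖T' y‖ ^ 2) {n m : ℕ}
    (hn : Module.finrank 𝕜 E = n) (hm : Module.finrank 𝕜 F = m) {i : Fin n} {j : Fin m}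
    (hij : i.val = j.val) : hS.eigenvalues hn i ≤ hS'.eigenvalues hm j := by
  rcases le_or_gt (hS.eigenvalues hn i) 0 with h0 | h0
  · exact h0.trans (LinearMap.IsPositive.nonneg_eigenvalues
      ⟨hS', fun y => by rw [hST']; positivity⟩ hm j)
  obtain ⟨V, hV, hVS⟩ := exists_submodule_le_re_inner hS hn i
  set r := hS.eigenvalues hn i
  have hinj : Function.Injective (T.domRestrict V) := by
    rw [← LinearMap.ker_eq_bot, LinearMap.ker_eq_bot']
    intro v hv
    have h1 := hVS v v.2
    rw [LinearMap.domRestrict_apply] at hv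
    rw [hST, hv, norm_zero, zero_pow two_ne_zero] at h1
    have h2 : ‖(v : E)‖ ^ 2 ≤ 0 := nonpos_of_mul_nonpos_right h1 h0
    exact Subtype.ext (norm_eq_zero.mp (pow_eq_zero_iff two_ne_zero |>.mp
      (le_antisymm h2 (sq_nonneg _))))
  refine le_eigenvalues_of_forall_mem hS' hm (V := LinearMap.range (T.domRestrict V)) ?_ ?_
  · rw [LinearMap.finrank_range_of_inj hinj]
    omega
  · rintro _ ⟨v, rfl⟩
    rw [LinearMap.domRestrict_apply, hST']
    have h1 := hVS v v.2
    rw [hST] at h1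
    have h2 : ‖T v‖ ^ 2 ≤ ‖(v : E)‖ * ‖T' (T v)‖ := by
      rw [← inner_self_eq_norm_sq (𝕜 := 𝕜), hadj]
      exact re_inner_le_norm _ _
    rcases eq_or_ne (T v) 0 with hv | hv
    · rw [hv, norm_zero]
      simp
    have h3 : 0 < ‖T v‖ ^ 2 := by positivity
    -- `r ‖Tv‖⁴ ≤ r ‖v‖² ‖T'Tv‖² ≤ ‖Tv‖² ‖T'Tv‖²`
    have h4 : (‖T v‖ ^ 2) ^ 2 ≤ (‖(v : E)‖ * ‖T' (T v)‖) ^ 2 := by gcongr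
    have h5 : r * (‖T v‖ ^ 2) ^ 2 ≤ ‖T v‖ ^ 2 * ‖T' (T v)‖ ^ 2 := by
      calc r * (‖T v‖ ^ 2) ^ 2 ≤ r * (‖(v : E)‖ * ‖T' (T v)‖) ^ 2 := by gcongr
        _ = (r * ‖(v : E)‖ ^ 2) * ‖T' (T v)‖ ^ 2 := by ring
        _ ≤ _ := by gcongr
    nlinarith

/-- `T*T` and `TT*` have the same eigenvalues up to zeros. The operators enter through their
quadratic forms, so that `S`, `S'` and the adjoint `T'` can be given in any shape. -/
theorem eigenvalues_adjoint_comp_eq {S : E →ₗ[𝕜] E} {S' : F →ₗ[𝕜] F} (hS : S.IsSymmetric)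
    (hS' : S'.IsSymmetric) {T : E →ₗ[𝕜] F} {T' : F →ₗ[𝕜] E} (hadj : ∀ x y, ⟪T x, y⟫ = ⟪x, T' y⟫)
    (hST : ∀ x, re ⟪S x, x⟫ = ‖T x‖ ^ 2) (hST' : ∀ y, re ⟪S' y, y⟫ = ‖T' y‖ ^ 2) {n m : ℕ}
    (hn : Module.finrank 𝕜 E = n) (hm : Module.finrank 𝕜 F = m) {i : Fin n} {j : Fin m}
    (hij : i.val = j.val) : hS.eigenvalues hn i = hS'.eigenvalues hm j := by
  refine le_antisymm (eigenvalues_adjoint_comp_le hS hS' hadj hST hST' hn hm hij)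
    (eigenvalues_adjoint_comp_le hS' hS (fun y x => ?_) hST' hST hm hn hij.symm)
  rw [← inner_conj_symm, ← hadj, inner_conj_symm]

/-! ### A Lidskii type inequality -/

/-- If `B ≤ C + s + N` with `N ≥ 0`, then any `|K|` of the differences `λᵢ(B) - λᵢ(C)` add up to at
most `|K| s + tr N`: each of them is at most `s` plus the nonnegative number `λᵢ(C + N) - λᵢ(C)`,
and all of these numbers together add up to the trace of `N`. -/
theorem sum_eigenvalues_sub_le {B C N : E →ₗ[𝕜] E} (hB : B.IsSymmetric) (hC : C.IsSymmetric)
    (hN : N.IsSymmetric) {s : ℝ} (hN0 : ∀ x, 0 ≤ re ⟪N x, x⟫)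
    (h : ∀ x, re ⟪B x, x⟫ ≤ re ⟪C x, x⟫ + s * ‖x‖ ^ 2 + re ⟪N x, x⟫)
    (K : Finset (Fin (Module.finrank 𝕜 E))) :
    ∑ i ∈ K, (hB.eigenvalues rfl i - hC.eigenvalues rfl i) ≤
      K.card * s + re (LinearMap.trace 𝕜 E N) := by
  have hD : (C + N).IsSymmetric := hC.add hN
  have hform : ∀ x, re ⟪(C + N) x, x⟫ = re ⟪C x, x⟫ + re ⟪N x, x⟫ := fun x => by
    rw [LinearMap.add_apply, inner_add_left, map_add]
  have hBD : ∀ i, hB.eigenvalues rfl i ≤ hD.eigenvalues rfl i + s := fun i => by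
    have := eigenvalues_add_le_eigenvalues hB hD rfl (s := -s)
      (fun x => by linarith [h x, hform x]) i
    linarith
  have hCD : ∀ i, hC.eigenvalues rfl i ≤ hD.eigenvalues rfl i := fun i => by
    have := eigenvalues_add_le_eigenvalues hC hD rfl (s := 0)
      (fun x => by linarith [hform x, hN0 x]) i
    linarith
  have htr : ∑ i, (hD.eigenvalues rfl i - hC.eigenvalues rfl i) = re (LinearMap.trace 𝕜 E N) := by
    rw [Finset.sum_sub_distrib, ← hD.re_trace_eq_sum_eigenvalues, ← hC.re_trace_eq_sum_eigenvalues,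
      map_add, map_add, add_sub_cancel_left]
  calc ∑ i ∈ K, (hB.eigenvalues rfl i - hC.eigenvalues rfl i)
      ≤ ∑ i ∈ K, (s + (hD.eigenvalues rfl i - hC.eigenvalues rfl i)) :=
        Finset.sum_le_sum fun i _ => by linarith [hBD i]
    _ = K.card * s + ∑ i ∈ K, (hD.eigenvalues rfl i - hC.eigenvalues rfl i) := by
        rw [Finset.sum_add_distrib, Finset.sum_const, nsmul_eq_mul]
    _ ≤ K.card * s + ∑ i, (hD.eigenvalues rfl i - hC.eigenvalues rfl i) := by
        gcongr
        · exact fun i _ _ => sub_nonneg.mpr (hCD i)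
        · exact Finset.subset_univ _
    _ = _ := by rw [htr]

/-- The eigenvalue changes from `G Q G` to `G P G` and from `G' Q G'` to `G' P G'`, where
`G² + G'² ≤ c`, are jointly controlled by a single copy of the spectrum of `P - Q`: the two
pieces `G (P - Q - t)₊ G` and `G' (P - Q - t)₊ G'` have total trace at most `c tr (P - Q - t)₊`. -/
theorem sum_eigenvalues_conj_sub_le {P Q G G' : E →ₗ[𝕜] E} (hP : P.IsSymmetric)
    (hQ : Q.IsSymmetric) (hG : G.IsSymmetric) (hG' : G'.IsSymmetric) {c t : ℝ} (ht : 0 ≤ t)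
    (hc : ∀ x, ‖G x‖ ^ 2 + ‖G' x‖ ^ 2 ≤ c * ‖x‖ ^ 2)
    (K K' : Finset (Fin (Module.finrank 𝕜 E))) :
    ∑ i ∈ K, ((isSymmetric_conj hG hP).eigenvalues rfl i -
        (isSymmetric_conj hG hQ).eigenvalues rfl i) +
      ∑ i ∈ K', ((isSymmetric_conj hG' hP).eigenvalues rfl i -
        (isSymmetric_conj hG' hQ).eigenvalues rfl i) ≤
      c * (t * (K.card + K'.card) + ∑ i, max ((hP.sub hQ).eigenvalues rfl i - t) 0) := by
  obtain ⟨R, hR, hR0, hRt, hRtr⟩ := exists_excess (hP.sub hQ) t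
  have hle : ∀ {L : E →ₗ[𝕜] E} (hL : L.IsSymmetric), (∀ x, ‖L x‖ ^ 2 ≤ c * ‖x‖ ^ 2) → ∀ K,
      ∑ i ∈ K, ((isSymmetric_conj hL hP).eigenvalues rfl i -
        (isSymmetric_conj hL hQ).eigenvalues rfl i) ≤
      K.card * (c * t) + re (LinearMap.trace 𝕜 E (R ∘ₗ L ∘ₗ L)) := fun {L} hL hLc K => by
    have htr : LinearMap.trace 𝕜 E (R ∘ₗ L ∘ₗ L) = LinearMap.trace 𝕜 E (L ∘ₗ R ∘ₗ L) := by
      rw [← LinearMap.comp_assoc, LinearMap.trace_comp_comm']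
    rw [htr]
    refine sum_eigenvalues_sub_le _ _ (isSymmetric_conj hL hR)
      (fun x => by rw [re_inner_conj hL]; exact hR0 _) (fun x => ?_) K
    rw [re_inner_conj hL, re_inner_conj hL, re_inner_conj hL]
    have h1 := hRt (L x)
    rw [LinearMap.sub_apply, inner_sub_left, map_sub] at h1
    have h2 := mul_le_mul_of_nonneg_left (hLc x) ht
    linarith
  have h1 := hle hG (fun x => by linarith [hc x, sq_nonneg ‖G' x‖]) K
  have h2 := hle hG' (fun x => by linarith [hc x, sq_nonneg ‖G x‖]) K'
  have h3 := hRtr (G ∘ₗ G + G' ∘ₗ G') c fun x => by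
    rw [LinearMap.add_apply, inner_add_left, map_add, LinearMap.comp_apply, LinearMap.comp_apply,
      hG, hG', inner_self_eq_norm_sq, inner_self_eq_norm_sq]
    exact hc x
  rw [LinearMap.comp_add, map_add, map_add] at h3
  linarith

end Operators

/-! ### Weak majorization from threshold inequalities -/

theorem decreasing_eq_self {n : ℕ} {y : Fin n → ℝ} (hy : Antitone y) : decreasing y = y := by
  have h : Monotone fun i => OrderDual.toDual (y i) := hy
  rw [decreasing, Tuple.sort_eq_refl_iff_monotone.mpr h]
  rfl

/-- To prove `|α - β| ≺_w c τ` it suffices to bound the sum of `α - β` over an arbitrary set `K` of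
indices plus the sum of `β - α` over another such set `K'` by `c (t |K| + t |K'| + ∑ (τⱼ - t)₊)`
for all levels `t ≥ 0`: for `t = τₖ` and `|K| + |K'| = k` the last bound is the sum of the `k`
largest entries of `c τ`. -/
theorem weaklyMajorizedBy_of_threshold {n : ℕ} {α β τ : Fin n → ℝ} {c : ℝ} (hc : 0 ≤ c)
    (hτ : Antitone τ) (hτ0 : ∀ i, 0 ≤ τ i)
    (h : ∀ (K K' : Finset (Fin n)) (t : ℝ), 0 ≤ t →
      ∑ i ∈ K, (α i - β i) + ∑ i ∈ K', (β i - α i) ≤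
        c * (t * (K.card + K'.card) + ∑ j, max (τ j - t) 0)) :
    WeaklyMajorizedBy (fun i => |α i - β i|) (fun i => c * τ i) := by
  intro k hk1 hkn
  have hanti : Antitone fun i => c * τ i := fun i j hij => mul_le_mul_of_nonneg_left (hτ hij) hc
  rw [decreasing_eq_self hanti]
  set σ := Tuple.sort (fun i => OrderDual.toDual |α i - β i|)
  set I : Finset (Fin n) := {i | i.val < k}
  set J := I.map σ.toEmbedding
  have hIcard : I.card = k := by
    simp only [I, Fin.card_filter_val_lt]
    omega
  have hJcard : J.card = k := by rw [Finset.card_map, hIcard]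
  have hlhs : ∑ i ∈ I, decreasing (fun i => |α i - β i|) i = ∑ i ∈ J, |α i - β i| := by
    rw [Finset.sum_map]
    rfl
  set t := τ ⟨k - 1, by omega⟩
  have hsplit : ∑ i ∈ J, |α i - β i| =
      ∑ i ∈ J with β i ≤ α i, (α i - β i) + ∑ i ∈ J with ¬ β i ≤ α i, (β i - α i) := by
    rw [← Finset.sum_filter_add_sum_filter_not J (fun i => β i ≤ α i)]
    congr 1
    · refine Finset.sum_congr rfl fun i hi => abs_of_nonneg (sub_nonneg.mpr ?_)
      exact (Finset.mem_filter.mp hi).2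
    · refine Finset.sum_congr rfl fun i hi => ?_
      rw [abs_of_neg (sub_neg.mpr (not_le.mp (Finset.mem_filter.mp hi).2)), neg_sub]
  have hcard : (((J.filter fun i => β i ≤ α i).card : ℝ) + (J.filter fun i => ¬ β i ≤ α i).card)
      = k := by
    rw [← hJcard]
    exact_mod_cast Finset.card_filter_add_card_filter_not (s := J) (fun i => β i ≤ α i)
  have hsum : t * k + ∑ j, max (τ j - t) 0 = ∑ i ∈ I, τ i := by
    have h1 : ∑ j, max (τ j - t) 0 = ∑ j ∈ I, (τ j - t) := by
      rw [← Finset.sum_subset (Finset.subset_univ I) fun j _ hj => ?_]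
      · refine Finset.sum_congr rfl fun j hj => max_eq_left (sub_nonneg.mpr (hτ ?_))
        have := (Finset.mem_filter.mp hj).2
        exact Fin.mk_le_mk.mpr (by omega)
      · refine max_eq_right (sub_nonpos.mpr (hτ ?_))
        have : ¬ j.val < k := fun hlt => hj (Finset.mem_filter.mpr ⟨Finset.mem_univ _, hlt⟩)
        exact Fin.mk_le_mk.mpr (by omega)
    rw [h1, Finset.sum_sub_distrib, Finset.sum_const, hIcard, nsmul_eq_mul]
    ring
  rw [hlhs, hsplit, ← Finset.mul_sum, ← hsum, ← hcard]
  exact h _ _ t (hτ0 _)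

/-- A vector of length `m ≥ n` whose first `n` entries are at most those of `τ` and whose other
entries are nonpositive exceeds a level `t ≥ 0` by no more than `τ` does. -/
theorem sum_max_sub_le_of_le {n m : ℕ} (hnm : n ≤ m) {μ : Fin m → ℝ} {τ : Fin n → ℝ}
    (h : ∀ j : Fin n, μ (Fin.castLE hnm j) ≤ τ j) (h0 : ∀ j : Fin m, n ≤ j.val → μ j ≤ 0)
    {t : ℝ} (ht : 0 ≤ t) : ∑ j, max (μ j - t) 0 ≤ ∑ j, max (τ j - t) 0 := by
  have h1 : ∑ j, max (μ j - t) 0 =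
      ∑ j ∈ Finset.univ.map (Fin.castLEEmb hnm), max (μ j - t) 0 := by
    refine (Finset.sum_subset (Finset.subset_univ _) fun j _ hj => ?_).symm
    refine max_eq_right ?_
    have : n ≤ j.val := by
      by_contra! hlt
      exact hj (Finset.mem_map.mpr ⟨⟨j, hlt⟩, Finset.mem_univ _, rfl⟩)
    linarith [h0 j this]
  rw [h1, Finset.sum_map]
  refine Finset.sum_le_sum fun j _ => ?_
  exact max_le_max (sub_le_sub_right (h j) t) le_rfl

/-! ### Ritz values -/

section Subspaces

variable {H : Type*} [NormedAddCommGroup H] [InnerProductSpace 𝕜 H] [FiniteDimensional 𝕜 H]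

theorem re_inner_compression (A : H →ₗ[𝕜] H) (X : Submodule 𝕜 H) (x : X) :
    re ⟪compression A X x, x⟫ = re ⟪A x, (x : H)⟫ := by
  simp [compression]

theorem norm_starProjection_sq (X : Submodule 𝕜 H) (v : H) :
    ‖X.starProjection v‖ ^ 2 = re ⟪X.starProjection v, v⟫ := by
  rw [← inner_self_eq_norm_sq (𝕜 := 𝕜), Submodule.inner_starProjection_left_eq_right,
    Submodule.starProjection_eq_self_iff.mpr (X.starProjection_apply_mem v),
    ← Submodule.inner_starProjection_left_eq_right]

/-- If `A = L* L`, the Ritz values of `A` on `X` are the leading eigenvalues of `L P_X L*`. -/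
theorem ritzValues_eq_eigenvalues {A L L' S : H →ₗ[𝕜] H} (hA : A.IsSymmetric) (hS : S.IsSymmetric)
    (X : Submodule 𝕜 H) (hadj : ∀ x y, ⟪L x, y⟫ = ⟪x, L' y⟫)
    (hAL : ∀ x, re ⟪A x, x⟫ = ‖L x‖ ^ 2) (hSL : ∀ y, re ⟪S y, y⟫ = ‖X.starProjection (L' y)‖ ^ 2)
    {n : ℕ} (hn : Module.finrank 𝕜 X = n) {i : Fin n} {j : Fin (Module.finrank 𝕜 H)}
    (hij : i.val = j.val) : ritzValues hA X hn i = hS.eigenvalues rfl j := by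
  refine eigenvalues_adjoint_comp_eq _ hS (T := L ∘ₗ X.subtype)
    (T' := (X.orthogonalProjectionOnto : H →ₗ[𝕜] X) ∘ₗ L') (fun x y => ?_) (fun x => ?_)
    (fun y => ?_) hn rfl hij
  · simp [hadj]
  · rw [re_inner_compression, hAL]
    rfl
  · rw [hSL]
    rfl

theorem ritzMin_le_ritzValues {A : H →ₗ[𝕜] H} (hA : A.IsSymmetric) (Z : Submodule 𝕜 H)
    (i : Fin (Module.finrank 𝕜 Z)) : ritzMin hA Z ≤ ritzValues hA Z rfl i :=
  ciInf_le (Set.finite_range _).bddBelow i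

theorem ritzValues_le_ritzMax {A : H →ₗ[𝕜] H} (hA : A.IsSymmetric) (Z : Submodule 𝕜 H)
    (i : Fin (Module.finrank 𝕜 Z)) : ritzValues hA Z rfl i ≤ ritzMax hA Z :=
  le_ciSup (Set.finite_range _).bddAbove i

theorem ritzMin_le_ritzMax {A : H →ₗ[𝕜] H} (hA : A.IsSymmetric) (Z : Submodule 𝕜 H) :
    ritzMin hA Z ≤ ritzMax hA Z := by
  rcases isEmpty_or_nonempty (Fin (Module.finrank 𝕜 Z)) with h | ⟨⟨i⟩⟩
  · rw [ritzMin, ritzMax, Real.iInf_of_isEmpty, Real.iSup_of_isEmpty]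
  · exact (ritzMin_le_ritzValues hA Z i).trans (ritzValues_le_ritzMax hA Z i)

theorem ritzMin_mul_le_re_inner {A : H →ₗ[𝕜] H} (hA : A.IsSymmetric) (Z : Submodule 𝕜 H) (z : Z) :
    ritzMin hA Z * ‖z‖ ^ 2 ≤ re ⟪A z, (z : H)⟫ := by
  have hs := compression_isSymmetric hA Z
  rw [← re_inner_compression, re_inner_eq_sum_eigenvalues hs rfl,
    ← (hs.eigenvectorBasis rfl).sum_sq_norm_inner_right z, Finset.mul_sum]
  refine Finset.sum_le_sum fun i _ => ?_
  gcongr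
  exact ritzMin_le_ritzValues hA Z i

theorem re_inner_le_ritzMax_mul {A : H →ₗ[𝕜] H} (hA : A.IsSymmetric) (Z : Submodule 𝕜 H) (z : Z) :
    re ⟪A z, (z : H)⟫ ≤ ritzMax hA Z * ‖z‖ ^ 2 := by
  have hs := compression_isSymmetric hA Z
  rw [← re_inner_compression, re_inner_eq_sum_eigenvalues hs rfl,
    ← (hs.eigenvectorBasis rfl).sum_sq_norm_inner_right z, Finset.mul_sum]
  refine Finset.sum_le_sum fun i _ => ?_
  gcongr
  exact ritzValues_le_ritzMax hA Z i

/-- The operator `P_Z (r A + s) P_Z`. -/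
def shiftOn (A : H →ₗ[𝕜] H) (r s : ℝ) (Z : Submodule 𝕜 H) : H →ₗ[𝕜] H :=
  (Z.starProjection : H →ₗ[𝕜] H) ∘ₗ ((r : 𝕜) • A + (s : 𝕜) • LinearMap.id) ∘ₗ
    (Z.starProjection : H →ₗ[𝕜] H)

theorem shiftOn_isSymmetric {A : H →ₗ[𝕜] H} (hA : A.IsSymmetric) (r s : ℝ) (Z : Submodule 𝕜 H) :
    (shiftOn A r s Z).IsSymmetric := by
  refine isSymmetric_conj Z.starProjection_isSymmetric fun x y => ?_
  simp [inner_add_left, inner_add_right, inner_smul_left, inner_smul_right, hA x y]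

theorem re_inner_shiftOn (A : H →ₗ[𝕜] H) (r s : ℝ) (Z : Submodule 𝕜 H) (v : H) :
    re ⟪shiftOn A r s Z v, v⟫ =
      r * re ⟪A (Z.starProjection v), Z.starProjection v⟫ + s * ‖Z.starProjection v‖ ^ 2 := by
  rw [shiftOn, re_inner_conj Z.starProjection_isSymmetric]
  simp [inner_add_left, inner_smul_left]

theorem shiftOn_apply_mem {A : H →ₗ[𝕜] H} {r s : ℝ} {X Z : Submodule 𝕜 H} (hXZ : X ≤ Z)
    (hX : ∀ x ∈ X, A x ∈ X) : ∀ x ∈ X, shiftOn A r s Z x ∈ X := by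
  intro x hx
  have h1 : Z.starProjection x = x := Submodule.starProjection_eq_self_iff.mpr (hXZ hx)
  have h2 : (r : 𝕜) • A x + (s : 𝕜) • x ∈ X := X.add_mem (X.smul_mem _ (hX x hx)) (X.smul_mem _ hx)
  have h3 : shiftOn A r s Z x = (r : 𝕜) • A x + (s : 𝕜) • x := by
    simp only [shiftOn, LinearMap.comp_apply, ContinuousLinearMap.coe_coe, h1]
    exact Submodule.starProjection_eq_self_iff.mpr (hXZ h2)
  rwa [h3]

theorem re_inner_compression_shiftOn (A : H →ₗ[𝕜] H) (r s : ℝ) {X Z : Submodule 𝕜 H} (hXZ : X ≤ Z)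
    (x : X) : re ⟪compression (shiftOn A r s Z) X x, x⟫ =
      r * re ⟪compression A X x, x⟫ + s * ‖x‖ ^ 2 := by
  have h1 : Z.starProjection x = x := Submodule.starProjection_eq_self_iff.mpr (hXZ x.2)
  rw [re_inner_compression, re_inner_compression, re_inner_shiftOn, h1]
  rfl

theorem ritzValues_shiftOn_one {A : H →ₗ[𝕜] H} (hA : A.IsSymmetric) (s : ℝ) {X Z : Submodule 𝕜 H}
    (hXZ : X ≤ Z) {n : ℕ} (hn : Module.finrank 𝕜 X = n) (i : Fin n) :
    ritzValues (shiftOn_isSymmetric hA 1 s Z) X hn i = ritzValues hA X hn i + s := by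
  refine eigenvalues_eq_add _ _ hn (fun x => ?_) i
  rw [re_inner_compression_shiftOn A 1 s hXZ, one_mul]

theorem ritzValues_shiftOn_neg_one {A : H →ₗ[𝕜] H} (hA : A.IsSymmetric) (s : ℝ)
    {X Z : Submodule 𝕜 H} (hXZ : X ≤ Z) {n : ℕ} (hn : Module.finrank 𝕜 X = n) (i : Fin n) :
    ritzValues (shiftOn_isSymmetric hA (-1) s Z) X hn i = s - ritzValues hA X hn i.rev := by
  refine eigenvalues_eq_sub_rev _ _ hn (fun x => ?_) i
  rw [re_inner_compression_shiftOn A (-1) s hXZ]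
  ring

/-- The common frame of both bounds. The operators `P`, `Q` are such that the changes of the Ritz
values of `P_Z (r A + s) P_Z = G²` are dominated by the eigenvalue changes from `G Q G` to `G P G`,
and `τ`, padded with zeros, dominates the spectrum of `P - Q`. -/
theorem weaklyMajorizedBy_ritzValues {A : H →ₗ[𝕜] H} (hA : A.IsSymmetric) {X Y Z : Submodule 𝕜 H}
    (hXZ : X ≤ Z) (hYZ : Y ≤ Z) {n : ℕ} (hX : Module.finrank 𝕜 X = n)
    (hY : Module.finrank 𝕜 Y = n) (hnm : n ≤ Module.finrank 𝕜 H) {P Q : H →ₗ[𝕜] H}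
    (hP : P.IsSymmetric) (hQ : Q.IsSymmetric)
    {τ : Fin n → ℝ} (hτ : Antitone τ) (hτ0 : ∀ i, 0 ≤ τ i)
    (hμ : ∀ j : Fin n, (hP.sub hQ).eigenvalues rfl (Fin.castLE hnm j) ≤ τ j)
    (hμ0 : ∀ j : Fin (Module.finrank 𝕜 H), n ≤ j.val → (hP.sub hQ).eigenvalues rfl j ≤ 0)
    (hcmp : ∀ (r s : ℝ) (G : H →ₗ[𝕜] H) (hG : G.IsSymmetric),
      (∀ x, G (G x) = shiftOn A r s Z x) → ∀ i : Fin n,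
      ritzValues (shiftOn_isSymmetric hA r s Z) X hX i -
        ritzValues (shiftOn_isSymmetric hA r s Z) Y hY i ≤
      (isSymmetric_conj hG hP).eigenvalues rfl (Fin.castLE hnm i) -
        (isSymmetric_conj hG hQ).eigenvalues rfl (Fin.castLE hnm i)) :
    WeaklyMajorizedBy (fun i => |ritzValues hA X hX i - ritzValues hA Y hY i|)
      (fun i => (ritzMax hA Z - ritzMin hA Z) * τ i) := by
  set a := ritzMin hA Z
  set b := ritzMax hA Z
  have hlow : ∀ v, a * ‖Z.starProjection v‖ ^ 2 ≤
      re ⟪A (Z.starProjection v), Z.starProjection v⟫ := fun v =>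
    ritzMin_mul_le_re_inner hA Z ⟨_, Z.starProjection_apply_mem v⟩
  have hupp : ∀ v, re ⟪A (Z.starProjection v), Z.starProjection v⟫ ≤
      b * ‖Z.starProjection v‖ ^ 2 := fun v =>
    re_inner_le_ritzMax_mul hA Z ⟨_, Z.starProjection_apply_mem v⟩
  obtain ⟨G, hG, hGA⟩ := exists_isSymmetric_sqrt (shiftOn_isSymmetric hA 1 (-a) Z) fun v => by
    rw [re_inner_shiftOn]
    linarith [hlow v]
  obtain ⟨G', hG', hGA'⟩ := exists_isSymmetric_sqrt (shiftOn_isSymmetric hA (-1) b Z) fun v => by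
    rw [re_inner_shiftOn]
    linarith [hupp v]
  have hab : 0 ≤ b - a := sub_nonneg.mpr (ritzMin_le_ritzMax hA Z)
  refine weaklyMajorizedBy_of_threshold hab hτ hτ0 fun K K' t ht => ?_
  have hc : ∀ v, ‖G v‖ ^ 2 + ‖G' v‖ ^ 2 ≤ (b - a) * ‖v‖ ^ 2 := fun v => by
    rw [← inner_self_eq_norm_sq (𝕜 := 𝕜) (G v), ← inner_self_eq_norm_sq (𝕜 := 𝕜) (G' v), ← hG,
      ← hG', hGA, hGA', re_inner_shiftOn, re_inner_shiftOn]
    have h1 : ‖Z.starProjection v‖ ^ 2 ≤ ‖v‖ ^ 2 := by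
      gcongr
      exact Z.norm_starProjection_apply_le v
    linarith [mul_le_mul_of_nonneg_left h1 hab]
  have hcore := sum_eigenvalues_conj_sub_le hP hQ hG hG' ht hc (K.map (Fin.castLEEmb hnm))
    ((K'.map Fin.revPerm.toEmbedding).map (Fin.castLEEmb hnm))
  rw [Finset.sum_map, Finset.sum_map, Finset.sum_map, Finset.card_map, Finset.card_map,
    Finset.card_map] at hcore
  have h1 := Finset.sum_le_sum fun i (_ : i ∈ K) => hcmp 1 (-a) G hG hGA i
  have h2 := Finset.sum_le_sum fun i (_ : i ∈ K') => hcmp (-1) b G' hG' hGA' i.rev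
  simp only [ritzValues_shiftOn_one hA _ hXZ, ritzValues_shiftOn_one hA _ hYZ,
    add_sub_add_right_eq_sub] at h1
  simp only [ritzValues_shiftOn_neg_one hA _ hXZ, ritzValues_shiftOn_neg_one hA _ hYZ,
    sub_sub_sub_cancel_left, Fin.rev_rev] at h2
  refine (add_le_add h1 h2).trans (hcore.trans ?_)
  gcongr
  exact sum_max_sub_le_of_le hnm hμ hμ0 ht

/-! ### Principal angles -/

theorem re_inner_compression_starProjection (X Y : Submodule 𝕜 H) (x : X) :
    re ⟪compression (Y.starProjection : H →ₗ[𝕜] H) X x, x⟫ = ‖Y.starProjection (x : H)‖ ^ 2 := by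
  rw [re_inner_compression, norm_starProjection_sq]
  rfl

theorem cosSqAngles_nonneg (X Y : Submodule 𝕜 H) {n : ℕ} (hn : Module.finrank 𝕜 X = n)
    (i : Fin n) : 0 ≤ cosSqAngles X Y hn i :=
  LinearMap.IsPositive.nonneg_eigenvalues
    ⟨compression_isSymmetric Y.starProjection_isSymmetric X, fun x => by
      rw [re_inner_compression_starProjection]; positivity⟩ hn i.rev

theorem cosSqAngles_le_one (X Y : Submodule 𝕜 H) {n : ℕ} (hn : Module.finrank 𝕜 X = n)
    (i : Fin n) : cosSqAngles X Y hn i ≤ 1 := by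
  refine eigenvalues_le_of_forall_mem _ hn (V := ⊤) (by rw [finrank_top]; omega) fun x _ => ?_
  rw [re_inner_compression_starProjection, one_mul]
  gcongr
  exact Y.norm_starProjection_apply_le (x : H)

theorem cosSqAngles_monotone (X Y : Submodule 𝕜 H) {n : ℕ} (hn : Module.finrank 𝕜 X = n) :
    Monotone (cosSqAngles X Y hn) := fun _ _ hij =>
  LinearMap.IsSymmetric.eigenvalues_antitone _ hn (Fin.rev_le_rev.mpr hij)

theorem cosSqAngles_comm (X Y : Submodule 𝕜 H) {n : ℕ} (hX : Module.finrank 𝕜 X = n)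
    (hY : Module.finrank 𝕜 Y = n) : cosSqAngles X Y hX = cosSqAngles Y X hY := by
  funext i
  refine eigenvalues_adjoint_comp_eq _ _
    (T := (Y.orthogonalProjectionOnto : H →ₗ[𝕜] Y) ∘ₗ X.subtype)
    (T' := (X.orthogonalProjectionOnto : H →ₗ[𝕜] X) ∘ₗ Y.subtype) (fun x y => ?_)
    (fun x => ?_) (fun y => ?_) hX hY rfl
  · simp
  · rw [re_inner_compression_starProjection]
    rfl
  · rw [re_inner_compression_starProjection]
    rfl

theorem principalAngles_comm (X Y : Submodule 𝕜 H) {n : ℕ} (hX : Module.finrank 𝕜 X = n)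
    (hY : Module.finrank 𝕜 Y = n) : principalAngles X Y hX = principalAngles Y X hY := by
  funext i
  rw [principalAngles, principalAngles, cosSqAngles_comm X Y hX hY]

theorem sin_principalAngles_nonneg (X Y : Submodule 𝕜 H) {n : ℕ} (hn : Module.finrank 𝕜 X = n)
    (i : Fin n) : 0 ≤ Real.sin (principalAngles X Y hn i) := by
  rw [principalAngles, Real.sin_arccos]
  positivity

theorem sin_sq_principalAngles (X Y : Submodule 𝕜 H) {n : ℕ} (hn : Module.finrank 𝕜 X = n)
    (i : Fin n) : Real.sin (principalAngles X Y hn i) ^ 2 = 1 - cosSqAngles X Y hn i := by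
  rw [principalAngles, Real.sin_arccos, Real.sq_sqrt (cosSqAngles_nonneg X Y hn i),
    Real.sq_sqrt (sub_nonneg.mpr (cosSqAngles_le_one X Y hn i))]

theorem sin_sq_principalAngles_antitone (X Y : Submodule 𝕜 H) {n : ℕ}
    (hn : Module.finrank 𝕜 X = n) :
    Antitone fun i => Real.sin (principalAngles X Y hn i) ^ 2 := fun i j hij => by
  simp only [sin_sq_principalAngles]
  linarith [cosSqAngles_monotone X Y hn hij]

theorem sin_principalAngles_antitone (X Y : Submodule 𝕜 H) {n : ℕ}
    (hn : Module.finrank 𝕜 X = n) :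
    Antitone fun i => Real.sin (principalAngles X Y hn i) := fun _ _ hij =>
  (pow_le_pow_iff_left₀ (sin_principalAngles_nonneg X Y hn _)
    (sin_principalAngles_nonneg X Y hn _) two_ne_zero).mp
    (sin_sq_principalAngles_antitone X Y hn hij)

/-- Outside the first `j` principal directions of `X`, the sine of the angle to `Y` is at most the
`j`-th one. The subspace consists of the remaining principal directions and of `Xᗮ`. -/
theorem exists_submodule_principalAngles (X Y : Submodule 𝕜 H) {n : ℕ}
    (hn : Module.finrank 𝕜 X = n) (j : Fin n) :
    ∃ V : Submodule 𝕜 H, Module.finrank 𝕜 V + j = Module.finrank 𝕜 H ∧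
      ∀ v ∈ V, ∃ x ∈ X, ∃ z ∈ Xᗮ, v = x + z ∧
        (1 - Real.sin (principalAngles X Y hn j) ^ 2) * ‖x‖ ^ 2 ≤ ‖Y.starProjection x‖ ^ 2 := by
  obtain ⟨W, hW, hWY⟩ := exists_submodule_le_re_inner
    (compression_isSymmetric (Y.starProjection_isSymmetric) X) hn j.rev
  refine ⟨W.map X.subtype ⊔ Xᗮ, ?_, fun v hv => ?_⟩
  · have h1 := Submodule.finrank_sup_add_finrank_inf_eq (W.map X.subtype) Xᗮ
    have h2 : W.map X.subtype ⊓ Xᗮ = ⊥ :=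
      ((Submodule.orthogonal_disjoint X).mono_left (Submodule.map_subtype_le X W)).eq_bot
    have h3 := X.finrank_add_finrank_orthogonal
    have h4 := Fin.val_rev j
    rw [h2, finrank_bot, Submodule.finrank_map_subtype_eq, hW] at h1
    omega
  · obtain ⟨_, ⟨w, hw, rfl⟩, z, hz, rfl⟩ := Submodule.mem_sup.mp hv
    refine ⟨_, w.2, z, hz, rfl, ?_⟩
    rw [sin_sq_principalAngles, sub_sub_cancel]
    have := hWY w hw
    rw [re_inner_compression_starProjection] at this
    exact this

theorem starProjection_add_of_mem {X : Submodule 𝕜 H} {x z : H} (hx : x ∈ X) (hz : z ∈ Xᗮ) :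
    X.starProjection (x + z) = x := by
  rw [map_add, Submodule.starProjection_eq_self_iff.mpr hx,
    X.starProjection_apply_eq_zero_iff.mpr hz, add_zero]

/-- The quadratic form of `P_X - P_Y` at `x + z`, where `x ∈ X` has an angle of sine at most `σ`
with `Y`, and `z ⟂ X`. -/
theorem norm_sq_sub_norm_starProjection_sq_le {X Y : Submodule 𝕜 H} {x z : H} (hx : x ∈ X)
    (hz : z ∈ Xᗮ) {σ : ℝ} (hσ : 0 ≤ σ) (h : (1 - σ ^ 2) * ‖x‖ ^ 2 ≤ ‖Y.starProjection x‖ ^ 2) :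
    ‖x‖ ^ 2 - ‖Y.starProjection (x + z)‖ ^ 2 ≤ σ * ‖x + z‖ ^ 2 := by
  set y := Y.starProjection x
  have hyx : re ⟪y, x⟫ = ‖y‖ ^ 2 := (norm_starProjection_sq Y x).symm
  have hzx : ⟪z, x⟫ = 0 := (Submodule.mem_orthogonal' X z).mp hz x hx
  -- Since `z ⟂ x`, the vector `y` may be replaced by `w`, which is small.
  set w := y - ((1 - σ ^ 2 : ℝ) : 𝕜) • x
  have hzw : re ⟪z, y⟫ = re ⟪z, w⟫ := by
    rw [inner_sub_right, inner_smul_right, hzx, mul_zero, sub_zero]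
  have hw : ‖w‖ ^ 2 = ‖y‖ ^ 2 - 2 * (1 - σ ^ 2) * ‖y‖ ^ 2 + (1 - σ ^ 2) ^ 2 * ‖x‖ ^ 2 := by
    rw [norm_sub_sq (𝕜 := 𝕜), inner_smul_right, re_ofReal_mul, hyx, norm_smul, mul_pow,
      norm_ofReal, sq_abs]
    ring
  have hzw' : -(‖z‖ * ‖w‖) ≤ re ⟪z, w⟫ :=
    neg_le_of_abs_le ((abs_re_le_norm _).trans (norm_inner_le_norm _ _))
  -- `q` is the projection onto `Y` of the whole vector; compare it with `y / (1 + σ)`.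
  set q := Y.starProjection (x + z)
  have hqy : re ⟪q, y⟫ = ‖y‖ ^ 2 + re ⟪z, y⟫ := by
    rw [Submodule.inner_starProjection_left_eq_right,
      Submodule.starProjection_eq_self_iff.mpr (Y.starProjection_apply_mem x), inner_add_left,
      map_add, inner_re_symm, hyx]
  have hq : 0 ≤ (1 + σ) ^ 2 * ‖q‖ ^ 2 - 2 * (1 + σ) * (‖y‖ ^ 2 + re ⟪z, y⟫) + ‖y‖ ^ 2 := by
    have h1 : ‖((1 + σ : ℝ) : 𝕜) • q - y‖ ^ 2 =
        (1 + σ) ^ 2 * ‖q‖ ^ 2 - 2 * (1 + σ) * (‖y‖ ^ 2 + re ⟪z, y⟫) + ‖y‖ ^ 2 := by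
      rw [norm_sub_sq (𝕜 := 𝕜), inner_smul_left, conj_ofReal, re_ofReal_mul, hqy, norm_smul,
        mul_pow, norm_ofReal, sq_abs]
      ring
    rw [← h1]
    positivity
  rw [norm_add_sq_of_mem_orthogonal hx hz]
  have hpos : 0 < (1 + σ) ^ 2 := by positivity
  refine le_of_mul_le_mul_left ?_ hpos
  rcases hσ.eq_or_lt with rfl | hσ0
  · have hw0 : ‖w‖ = 0 := by
      have : ‖w‖ ^ 2 ≤ 0 := by rw [hw]; nlinarith
      exact pow_eq_zero_iff two_ne_zero |>.mp (le_antisymm this (sq_nonneg _))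
    rw [hw0] at hzw'
    nlinarith
  · -- Young's inequality with the weights for which equality can occur
    have hyoung : 2 * (1 + σ) * (‖z‖ * ‖w‖) ≤ σ * (1 + σ) ^ 2 * ‖z‖ ^ 2 + ‖w‖ ^ 2 / σ := by
      have h1 : σ * (1 + σ) ^ 2 * ‖z‖ ^ 2 + ‖w‖ ^ 2 / σ - 2 * (1 + σ) * (‖z‖ * ‖w‖) =
          (σ * (1 + σ) * ‖z‖ - ‖w‖) ^ 2 / σ := by
        field_simp
        ring
      have h2 : 0 ≤ (σ * (1 + σ) * ‖z‖ - ‖w‖) ^ 2 / σ := by positivity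
      linarith
    have hmain : (1 + σ) ^ 2 * ‖x‖ ^ 2 - (1 + 2 * σ) * ‖y‖ ^ 2 + ‖w‖ ^ 2 / σ ≤
        σ * (1 + σ) ^ 2 * ‖x‖ ^ 2 := by
      have h1 : σ * (1 + σ) ^ 2 * ‖x‖ ^ 2 -
          ((1 + σ) ^ 2 * ‖x‖ ^ 2 - (1 + 2 * σ) * ‖y‖ ^ 2 + ‖w‖ ^ 2 / σ) =
          (1 + σ) / σ * (‖y‖ ^ 2 - (1 - σ ^ 2) * ‖x‖ ^ 2) := by
        rw [hw]
        field_simp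
        ring
      have h2 : 0 ≤ (1 + σ) / σ * (‖y‖ ^ 2 - (1 - σ ^ 2) * ‖x‖ ^ 2) :=
        mul_nonneg (by positivity) (sub_nonneg.mpr h)
      linarith
    rw [hzw] at hq
    have h3 := mul_le_mul_of_nonneg_left hzw' (by positivity : 0 ≤ 2 * (1 + σ))
    linarith

/-! ### The two majorization bounds -/

theorem weaklyMajorizedBy_sin {A : H →ₗ[𝕜] H} (hA : A.IsSymmetric) {X Y : Submodule 𝕜 H} {n : ℕ}
    (hX : Module.finrank 𝕜 X = n) (hY : Module.finrank 𝕜 Y = n) :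
    WeaklyMajorizedBy (fun i => |ritzValues hA X hX i - ritzValues hA Y hY i|)
      (fun i => (ritzMax hA (X ⊔ Y) - ritzMin hA (X ⊔ Y)) *
        Real.sin (principalAngles X Y hX i)) := by
  have hnm : n ≤ Module.finrank 𝕜 H := hX ▸ X.finrank_le
  have hform : ∀ v, re ⟪((X.starProjection : H →ₗ[𝕜] H) - (Y.starProjection : H →ₗ[𝕜] H)) v, v⟫ =
      ‖X.starProjection v‖ ^ 2 - ‖Y.starProjection v‖ ^ 2 := fun v => by
    rw [LinearMap.sub_apply, inner_sub_left, map_sub, norm_starProjection_sq,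
      norm_starProjection_sq]
    rfl
  refine weaklyMajorizedBy_ritzValues hA le_sup_left le_sup_right hX hY hnm
    X.starProjection_isSymmetric Y.starProjection_isSymmetric
    (sin_principalAngles_antitone X Y hX) (sin_principalAngles_nonneg X Y hX)
    (fun j => ?_) (fun j hj => ?_) (fun r s G hG hGA i => le_of_eq ?_)
  · obtain ⟨V, hV, hVY⟩ := exists_submodule_principalAngles X Y hX j
    refine eigenvalues_le_of_forall_mem _ rfl (V := V) hV.ge fun v hv => ?_
    obtain ⟨x, hx, z, hz, rfl, hxz⟩ := hVY v hv
    rw [hform, starProjection_add_of_mem hx hz]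
    exact norm_sq_sub_norm_starProjection_sq_le hx hz (sin_principalAngles_nonneg X Y hX j) hxz
  · refine eigenvalues_le_of_forall_mem _ rfl (V := Xᗮ) ?_ fun v hv => ?_
    · have := X.finrank_add_finrank_orthogonal
      omega
    · rw [hform, X.starProjection_apply_eq_zero_iff.mpr hv, norm_zero]
      linarith [sq_nonneg ‖Y.starProjection v‖]
  · have hritz : ∀ (U : Submodule 𝕜 H) (hU : Module.finrank 𝕜 U = n),
        ritzValues (shiftOn_isSymmetric hA r s (X ⊔ Y)) U hU i =
        (isSymmetric_conj hG U.starProjection_isSymmetric).eigenvalues rfl (Fin.castLE hnm i) :=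
      fun U hU => ritzValues_eq_eigenvalues _ _ U hG
        (fun x => by rw [← hGA, hG, inner_self_eq_norm_sq])
        (fun y => by rw [re_inner_conj hG, norm_starProjection_sq]; rfl) hU rfl
    rw [hritz X hX, hritz Y hY]

/-- If `X` is `A`-invariant, then on `Y` the operator `B = G²` dominates `P_X B P_X`, whose Ritz
values on `Y` are the eigenvalues of `G (P_X P_Y P_X) G`. -/
theorem weaklyMajorizedBy_sin_sq {A : H →ₗ[𝕜] H} (hA : A.IsSymmetric) {X Y : Submodule 𝕜 H} {n : ℕ}
    (hX : Module.finrank 𝕜 X = n) (hY : Module.finrank 𝕜 Y = n) (hinv : ∀ x ∈ X, A x ∈ X) :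
    WeaklyMajorizedBy (fun i => |ritzValues hA X hX i - ritzValues hA Y hY i|)
      (fun i => (ritzMax hA (X ⊔ Y) - ritzMin hA (X ⊔ Y)) *
        Real.sin (principalAngles X Y hX i) ^ 2) := by
  have hnm : n ≤ Module.finrank 𝕜 H := hX ▸ X.finrank_le
  have hPX : (X.starProjection : H →ₗ[𝕜] H).IsSymmetric := X.starProjection_isSymmetric
  have hQ := isSymmetric_conj hPX (Y.starProjection_isSymmetric)
  have hform : ∀ v, re ⟪((X.starProjection : H →ₗ[𝕜] H) - (X.starProjection : H →ₗ[𝕜] H) ∘ₗ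
      (Y.starProjection : H →ₗ[𝕜] H) ∘ₗ (X.starProjection : H →ₗ[𝕜] H)) v, v⟫ =
      ‖X.starProjection v‖ ^ 2 - ‖Y.starProjection (X.starProjection v)‖ ^ 2 := fun v => by
    rw [LinearMap.sub_apply, inner_sub_left, map_sub, re_inner_conj hPX, norm_starProjection_sq,
      norm_starProjection_sq]
    rfl
  refine weaklyMajorizedBy_ritzValues hA le_sup_left le_sup_right hX hY hnm hPX hQ
    (sin_sq_principalAngles_antitone X Y hX) (fun i => sq_nonneg _)
    (fun j => ?_) (fun j hj => ?_) (fun r s G hG hGA i => ?_)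
  · obtain ⟨V, hV, hVY⟩ := exists_submodule_principalAngles X Y hX j
    refine eigenvalues_le_of_forall_mem _ rfl (V := V) hV.ge fun v hv => ?_
    obtain ⟨x, hx, z, hz, rfl, hxz⟩ := hVY v hv
    rw [hform, starProjection_add_of_mem hx hz, norm_add_sq_of_mem_orthogonal hx hz]
    have : 0 ≤ Real.sin (principalAngles X Y hX j) ^ 2 * ‖z‖ ^ 2 := by positivity
    linarith
  · refine eigenvalues_le_of_forall_mem _ rfl (V := Xᗮ) ?_ fun v hv => ?_
    · have := X.finrank_add_finrank_orthogonal
      omega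
    · rw [hform, X.starProjection_apply_eq_zero_iff.mpr hv, map_zero]
      simp
  · set B := shiftOn A r s (X ⊔ Y)
    have hB : B.IsSymmetric := shiftOn_isSymmetric hA r s (X ⊔ Y)
    have hBinv : ∀ x ∈ X, B x ∈ X := shiftOn_apply_mem le_sup_left hinv
    have hBG : ∀ x, re ⟪B x, x⟫ = ‖G x‖ ^ 2 := fun x => by
      rw [← hGA, hG, inner_self_eq_norm_sq]
    have hritzX : ritzValues hB X hX i =
        (isSymmetric_conj hG hPX).eigenvalues rfl (Fin.castLE hnm i) :=
      ritzValues_eq_eigenvalues _ _ X hG hBG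
        (fun y => by rw [re_inner_conj hG, norm_starProjection_sq]; rfl) hX rfl
    have hC := isSymmetric_conj hPX hB
    have hritzC : ritzValues hC Y hY i =
        (isSymmetric_conj hG hQ).eigenvalues rfl (Fin.castLE hnm i) :=
      ritzValues_eq_eigenvalues (L := G ∘ₗ (X.starProjection : H →ₗ[𝕜] H))
        (L' := (X.starProjection : H →ₗ[𝕜] H) ∘ₗ G) _ _ Y
        (fun x y => by rw [LinearMap.comp_apply, LinearMap.comp_apply, hG, hPX])
        (fun x => by rw [re_inner_conj hPX, hBG]; rfl)
        (fun y => by rw [re_inner_conj hG, re_inner_conj hPX, norm_starProjection_sq]; rfl) hY rfl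
    have hCY : ritzValues hC Y hY i ≤ ritzValues hB Y hY i := by
      have := eigenvalues_add_le_eigenvalues (compression_isSymmetric hC Y)
        (compression_isSymmetric hB Y) hY (s := 0) (fun y => ?_) i
      · rwa [add_zero] at this
      rw [zero_mul, add_zero, re_inner_compression, re_inner_compression, re_inner_conj hPX]
      obtain ⟨p, hpy⟩ : ∃ p, p = X.starProjection (y : H) := ⟨_, rfl⟩
      have hp : p ∈ X := hpy ▸ X.starProjection_apply_mem _
      obtain ⟨q, hqy⟩ : ∃ q, q = (y : H) - p := ⟨_, rfl⟩
      have hq : q ∈ Xᗮ := by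
        rw [hqy, hpy]
        exact X.sub_starProjection_mem_orthogonal _
      have hy : (y : H) = p + q := by rw [hqy, add_sub_cancel]
      have h1 : ⟪B p, q⟫ = 0 := hq _ (hBinv p hp)
      have h2 : ⟪B q, p⟫ = 0 := by
        rw [hB, ← inner_conj_symm, h1, map_zero]
      have h3 : 0 ≤ re ⟪B q, q⟫ := by rw [hBG]; positivity
      rw [ContinuousLinearMap.coe_coe, ← hpy, hy, map_add, inner_add_left, inner_add_right,
        inner_add_right, h1, h2, add_zero, zero_add, map_add]
      exact le_add_of_nonneg_right h3
    rw [← hritzX, ← hritzC]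
    exact sub_le_sub_left hCY _

theorem weaklyMajorizedBy_sin_sq_right {A : H →ₗ[𝕜] H} (hA : A.IsSymmetric) {X Y : Submodule 𝕜 H}
    {n : ℕ} (hX : Module.finrank 𝕜 X = n) (hY : Module.finrank 𝕜 Y = n)
    (hinv : ∀ y ∈ Y, A y ∈ Y) :
    WeaklyMajorizedBy (fun i => |ritzValues hA X hX i - ritzValues hA Y hY i|)
      (fun i => (ritzMax hA (X ⊔ Y) - ritzMin hA (X ⊔ Y)) *
        Real.sin (principalAngles X Y hX i) ^ 2) := by
  rw [principalAngles_comm X Y hX hY, sup_comm]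
  simp_rw [abs_sub_comm (ritzValues hA X hX _)]
  exact weaklyMajorizedBy_sin_sq hA hY hX hinv

end Subspaces

end

end RayleighRitz

theorem theorem2p1 {𝕜 H : Type*} [RCLike 𝕜] [NormedAddCommGroup H] [InnerProductSpace 𝕜 H]
    [FiniteDimensional 𝕜 H] (A : H →ₗ[𝕜] H) (hA : A.IsSymmetric) (X Y : Submodule 𝕜 H) (n : ℕ)
    (hX : Module.finrank 𝕜 X = n) (hY : Module.finrank 𝕜 Y = n) :
    RayleighRitz.WeaklyMajorizedBy
      (fun i => |RayleighRitz.ritzValues hA X hX i - RayleighRitz.ritzValues hA Y hY i|)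
      (fun i => (RayleighRitz.ritzMax hA (X ⊔ Y) - RayleighRitz.ritzMin hA (X ⊔ Y)) *
        Real.sin (RayleighRitz.principalAngles X Y hX i)) ∧
    ((∀ x ∈ X, A x ∈ X) ∨ (∀ y ∈ Y, A y ∈ Y) →
      RayleighRitz.WeaklyMajorizedBy
        (fun i => |RayleighRitz.ritzValues hA X hX i - RayleighRitz.ritzValues hA Y hY i|)
        (fun i => (RayleighRitz.ritzMax hA (X ⊔ Y) - RayleighRitz.ritzMin hA (X ⊔ Y)) *
          Real.sin (RayleighRitz.principalAngles X Y hX i) ^ 2)) := by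
  exact ⟨RayleighRitz.weaklyMajorizedBy_sin hA hX hY, fun h =>
    h.elim (RayleighRitz.weaklyMajorizedBy_sin_sq hA hX hY)
      (RayleighRitz.weaklyMajorizedBy_sin_sq_right hA hX hY)⟩
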